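/- Let $q$ be a power of an odd prime, $\psi$ a non-trivial additive character $\mathbb{F}_q\to\mathbb{C}^\ast$, and $\varepsilon\in\mathbb{F}_q^\ast$ a non-square. For a symplectic space $(W,\langle\,,\rangle)$ over $\mathbb{F}_q$ let $H=W\times\mathbb{F}_q$ be the Heisenberg group, with $(w,z)(w',z')=(w+w',z+z'+\tfrac12\langle w,w'\rangle)$. A Heisenberg representation with central character $\psi$ is an irreducible complex representation $\pi_\psi$ of $H$ with $\pi_\psi(0,z)=\psi(z)I$; it is unique up to isomorphism. The oscillator representation of $Sp(W)$ attached to $\psi$ is the representation $\omega$ of $Sp(W)$ on the space of $\pi_\psi$ such that $\omega(g)\pi_\psi(w,z)\omega(g)^{-1}=\pi_\psi(gw,z)$ for all $g\in Sp(W)$ and $(w,z)\in H$. It is unique up to isomorphism, except when $q=3$ and $\dim W=2$; in that case the canonical one is meant, for which every $g\in Sp(W)$ that fixes a vector $w\neq 0$ also fixes every vector which is fixed by $\pi_\psi(w,0)$. Let $V=\mathbb{F}_q^2$ with the symplectic form $\langle v,v'\rangle_V=v_1v_2'-v_2v_1'$, and let $G=SL_2(\mathbb{F}_q)=Sp(V)$.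 For a finite-dimensional space $U$ over $\mathbb{F}_q$ with a non-degenerate symmetric bilinear form $\beta$, let $\omega_{U\otimes V}$ be the oscillator representation attached to $\psi$ of $Sp(U\otimes V)$, where $U\otimes V$ carries the form $\beta\otimes\langle\,,\rangle_V$; the group $G$ acts on $U\otimes V$ through the second factor, and this gives a homomorphism $G\to Sp(U\otimes V)$ and a restriction $\omega_{U\otimes V|G}$. For $U=\mathbb{F}_q$ with $\beta(x,x)=x^2$, respectively $\beta(x,x)=\varepsilon x^2$, write $\omega_{\psi+}$, respectively $\omega_{\psi-}$, for $\omega_{U\otimes V|G}$. Proposition. Assume that $\dim U=2$. If $(U,\beta)$ is a hyperbolic plane, that is, isometric to $\mathbb{F}_q^2$ with the form $x^2-y^2$, then, as representations of $G$, $$\omega_{U\otimes V|G}\;\simeq\;\begin{cases}\omega_{\psi+}\otimes\omega_{\psi+} & \text{if } q\equiv 1 \bmod 4,\\ \omega_{\psi+}\otimes\omega_{\psi-} & \text{if } q\equiv 3 \bmod 4.\end{cases}$$ If $(U,\beta)$ is an anisotropic plane, that is, isometric to $\mathbb{F}_q^2$ with the form $x^2-\varepsilon y^2$, then, as representations of $G$,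 $$\omega_{U\otimes V|G}\;\simeq\;\begin{cases}\omega_{\psi+}\otimes\omega_{\psi-} & \text{if } q\equiv 1 \bmod 4,\\ \omega_{\psi+}\otimes\omega_{\psi+} & \text{if } q\equiv 3 \bmod 4.\end{cases}$$ -/

import Mathlib

open scoped TensorProduct

noncomputable section

/-! ### Symplectic groups and Heisenberg groups of a bilinear form -/

section General

variable {F W : Type*} [Field F] [AddCommGroup W] [Module F W]

/-- The group `Sp(W)` of linear automorphisms of `W` which preserve the form `B`. -/
def SpGroup (B : LinearMap.BilinForm F W) : Subgroup (W ≃ₗ[F] W) where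
  carrier := {g | ∀ v w, B (g v) (g w) = B v w}
  one_mem' := fun _ _ => rfl
  mul_mem' := fun {a b} ha hb v w => by
    simp only [Set.mem_ofPred_eq, LinearEquiv.mul_apply] at *
    rw [ha, hb]
  inv_mem' := fun {a} ha v w => by
    simp only [Set.mem_ofPred_eq] at *
    rw [← ha (a⁻¹ v) (a⁻¹ w)]
    simp only [← LinearEquiv.mul_apply, mul_inv_cancel, LinearEquiv.coe_one, id_eq]

/-- The underlying set `W × F` of the Heisenberg group attached to `(W, B)`. -/
@[ext]
structure Heisenberg (B : LinearMap.BilinForm F W) where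
  /-- the component in `W` -/
  vec : W
  /-- the central component -/
  cen : F

namespace Heisenberg

variable {B : LinearMap.BilinForm F W}

instance : One (Heisenberg B) := ⟨⟨0, 0⟩⟩

/-- `(w, z) (w', z') = (w + w', z + z' + ½ ⟨w, w'⟩)`. -/
instance : Mul (Heisenberg B) :=
  ⟨fun h k => ⟨h.vec + k.vec, h.cen + k.cen + (2 : F)⁻¹ * B h.vec k.vec⟩⟩

/-- The correction term vanishes when `B` is alternating. -/
instance : Inv (Heisenberg B) :=
  ⟨fun h => ⟨-h.vec, -h.cen + (2 : F)⁻¹ * B h.vec h.vec⟩⟩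

@[simp] lemma one_vec : (1 : Heisenberg B).vec = 0 := rfl
@[simp] lemma one_cen : (1 : Heisenberg B).cen = 0 := rfl
@[simp] lemma mul_vec (h k : Heisenberg B) : (h * k).vec = h.vec + k.vec := rfl
@[simp] lemma mul_cen (h k : Heisenberg B) :
    (h * k).cen = h.cen + k.cen + (2 : F)⁻¹ * B h.vec k.vec := rfl
@[simp] lemma inv_vec (h : Heisenberg B) : h⁻¹.vec = -h.vec := rfl
@[simp] lemma inv_cen (h : Heisenberg B) :
    h⁻¹.cen = -h.cen + (2 : F)⁻¹ * B h.vec h.vec := rfl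

instance : Group (Heisenberg B) :=
  Group.ofLeftAxioms
    (fun a b c => by
      ext
      · simp [add_assoc]
      · simp; ring)
    (fun a => by ext <;> simp)
    (fun a => by ext <;> simp)

/-- The action `g (w, z) = (g w, z)` of `Sp(W)` on the Heisenberg group. -/
def act (g : SpGroup B) (h : Heisenberg B) : Heisenberg B :=
  ⟨(g : W ≃ₗ[F] W) h.vec, h.cen⟩

end Heisenberg

/-! ### Heisenberg and oscillator representations -/

variable {B : LinearMap.BilinForm F W} {E : Type*} [AddCommGroup E] [Module ℂ E]

/-- `π` is a Heisenberg representation with central character `ψ`: it is irreducible, and the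
central element `(0, z)` acts by the scalar `ψ z`. -/
structure IsHeisenbergRep (ψ : AddChar F ℂ) (π : Representation ℂ (Heisenberg B) E) : Prop where
  irreducible : π.IsIrreducible
  central : ∀ (z : F) (v : E), π ⟨0, z⟩ v = ψ z • v

/-- `ω` is the oscillator representation of `Sp(W)` attached to the central character `ψ`: it is
realized on the space of a Heisenberg representation `π` with central character `ψ`, and
`ω(g) π(h) ω(g)⁻¹ = π(g(h))` for all `g` and `h`.

This condition determines `ω` except when `#F = 3` and `dim W = 2`, where three such `ω` exist.
They differ by the characters of `SL₂(𝔽₃)`, and the last clause selects the canonical one, for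
which a transvection fixing `w ≠ 0` fixes the vectors which are invariant under the Lagrangian line
spanned by `w`. In the Schrödinger model on functions on a complementary line this is the usual
normalization: unipotent elements act by `f(y) ↦ ψ(½ A(y,y)) f(y)`, so they fix the delta function
at `0`. -/
def IsOscillatorRep (ψ : AddChar F ℂ) (ω : Representation ℂ (SpGroup B) E) : Prop :=
  ∃ π : Representation ℂ (Heisenberg B) E,
    IsHeisenbergRep ψ π ∧
    (∀ (g : SpGroup B) (h : Heisenberg B), ω g ∘ₗ π h ∘ₗ ω g⁻¹ = π (Heisenberg.act g h)) ∧
    (Nat.card F = 3 → Module.finrank F W = 2 →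
      ∀ (g : SpGroup B) (w : W) (v : E), w ≠ 0 → (g : W ≃ₗ[F] W) w = w →
        π ⟨w, 0⟩ v = v → ω g v = v)

end General

/-! ### The dual pair -/

section DualPair

variable (F : Type*) [Field F]

/-- The symplectic form `⟨v, v'⟩ = v₀ v'₁ - v₁ v'₀` on the plane `V = F²`. -/
def sympV : LinearMap.BilinForm F (Fin 2 → F) := Matrix.toBilin' !![0, 1; -1, 0]

variable {F}

/-- The form `c x x'` on the line `F`. -/
def lineForm (c : F) : LinearMap.BilinForm F F := c • LinearMap.mul F F

/-- The form `x x' - c y y'` on the plane `F²`. -/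
def planeForm (c : F) : LinearMap.BilinForm F (Fin 2 → F) := Matrix.toBilin' !![1, 0; 0, -c]

variable {U : Type*} [AddCommGroup U] [Module F U]

/-- The form `β ⊗ ⟨ , ⟩` on `U ⊗ V`. -/
def tensorForm (β : LinearMap.BilinForm F U) : LinearMap.BilinForm F (U ⊗[F] (Fin 2 → F)) :=
  LinearMap.BilinForm.tmul β (sympV F)

lemma sympV_apply (v w : Fin 2 → F) : sympV F v w = v 0 * w 1 - v 1 * w 0 := by
  simp [sympV, Matrix.toBilin'_apply, Fin.sum_univ_two]
  ring

lemma sympV_toLin' (g : Matrix.SpecialLinearGroup (Fin 2) F) (v w : Fin 2 → F) :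
    sympV F (Matrix.SpecialLinearGroup.toLin' g v) (Matrix.SpecialLinearGroup.toLin' g w) =
      sympV F v w := by
  have hd : g.1 0 0 * g.1 1 1 - g.1 0 1 * g.1 1 0 = 1 := by
    rw [← Matrix.det_fin_two]; exact g.2
  simp only [sympV_apply, Matrix.SpecialLinearGroup.toLin'_apply, Matrix.toLin'_apply,
    Matrix.mulVec, dotProduct, Fin.sum_univ_two]
  linear_combination (v 0 * w 1 - v 1 * w 0) * hd

/-- The embedding of `G = SL₂(F)` in `Sp(U ⊗ V)` through the action on the second factor. -/
def slToSp (β : LinearMap.BilinForm F U) :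
    Matrix.SpecialLinearGroup (Fin 2) F →* SpGroup (tensorForm β) where
  toFun g := ⟨TensorProduct.congr (LinearEquiv.refl F U) (Matrix.SpecialLinearGroup.toLin' g), by
    intro x y
    induction x using TensorProduct.induction_on with
    | zero => simp
    | add x x' hx hx' => simp only [map_add, LinearMap.add_apply, hx, hx']
    | tmul u v =>
      induction y using TensorProduct.induction_on with
      | zero => simp
      | add y y' hy hy' => simp only [map_add, hy, hy']
      | tmul u' v' =>
        simp only [tensorForm, TensorProduct.congr_tmul, LinearEquiv.refl_apply,
          LinearMap.BilinForm.tensorDistrib_tmul, sympV_toLin']⟩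
  map_one' := by
    apply Subtype.ext
    apply LinearEquiv.toLinearMap_injective
    ext u i
    simp
  map_mul' g h := by
    apply Subtype.ext
    apply LinearEquiv.toLinearMap_injective
    ext u i
    simp

variable {E : Type*} [AddCommGroup E] [Module ℂ E]

/-- The restriction to `G = SL₂(F)` of a representation of `Sp(U ⊗ V)`. -/
def resSL {β : LinearMap.BilinForm F U} (ω : Representation ℂ (SpGroup (tensorForm β)) E) :
    Representation ℂ (Matrix.SpecialLinearGroup (Fin 2) F) E :=
  ω.comp (slToSp β)

end DualPair

end

/-! If `U = U₁ ⊕ U₂` is an orthogonal sum, then the tensor product of Heisenberg representations of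
`U₁ ⊗ V` and `U₂ ⊗ V` is one of `U ⊗ V`: a representation with a non-trivial central character is
irreducible as soon as the square of its dimension is `#(U ⊗ V)`. By the Stone–von Neumann theorem,
`ω_{U ⊗ V}` and `ω_{U₁ ⊗ V} ⊗ ω_{U₂ ⊗ V}`, restricted to `SL₂(F)`, therefore agree up to a character
`χ` of `SL₂(F)`. Let `e` be a coordinate vector of `V`. The vectors fixed by the Lagrangian `U ⊗ e`
form a line, on which its stabilizer in `Sp(U ⊗ V)` acts by a character. A transvection fixing `e`
is a commutator in this stabilizer, namely with the tensor product of a similitude of `U` and a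
diagonal similitude of `V`, so it fixes that line. (For lines `U` over `𝔽₃` this is the
normalization of the oscillator representation.) Comparing fixed vectors gives `χ = 1` on
transvections, which generate `SL₂(F)`.

The form `x² - c y²` is isometric to `x² + a y²` whenever `-c a` is a square, and whether
`-1` and `-ε` are squares depends on `q mod 4`. -/

noncomputable section

section Irreducible

open scoped MonoidAlgebra

variable {k G E : Type*} [Field k] [Monoid G] [AddCommGroup E] [Module k E]
  (ρ : Representation k G E)

lemma nontrivial_of_isIrreducible [ρ.IsIrreducible] : Nontrivial E := by
  by_contra hE
  rw [not_nontrivial_iff_subsingleton] at hE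
  exact bot_ne_top (α := Subrepresentation ρ)
    (Subrepresentation.toSubmodule_injective (Subsingleton.elim _ _))

lemma isIrreducible_of_forall_subrepresentation [Nontrivial E]
    (h : ∀ N : Subrepresentation ρ, N.toSubmodule ≠ ⊥ → N.toSubmodule = ⊤) :
    ρ.IsIrreducible where
  exists_pair_ne := ⟨⊥, ⊤, fun h => bot_ne_top (congrArg Subrepresentation.toSubmodule h)⟩
  eq_bot_or_eq_top N := by
    by_cases hN : N.toSubmodule = ⊥
    · exact .inl (Subrepresentation.toSubmodule_injective hN)
    · exact .inr (Subrepresentation.toSubmodule_injective (h N hN))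

lemma span_orbit_eq_top [ρ.IsIrreducible] {v : E} (hv : v ≠ 0) :
    Submodule.span k (Set.range fun g => ρ g v) = ⊤ := by
  let N : Subrepresentation ρ := ⟨Submodule.span k (Set.range fun g => ρ g v), fun g x hx => by
    induction hx using Submodule.span_induction with
    | mem x hx =>
      obtain ⟨g', rfl⟩ := hx
      exact Submodule.subset_span ⟨g * g', by simp⟩
    | zero => simp
    | add x y _ _ hx hy => rw [map_add]; exact add_mem hx hy
    | smul c x _ hx => rw [map_smul]; exact Submodule.smul_mem _ _ hx⟩
  rcases eq_bot_or_eq_top N with hN | hN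
  · have hvN : v ∈ N.toSubmodule := Submodule.subset_span ⟨1, by simp⟩
    rw [hN] at hvN
    exact absurd ((Submodule.mem_bot k).1 hvN) hv
  · exact congrArg Subrepresentation.toSubmodule hN

lemma finiteDimensional_of_isIrreducible [Finite G] [ρ.IsIrreducible] :
    FiniteDimensional k E := by
  have := nontrivial_of_isIrreducible ρ
  obtain ⟨v, hv⟩ := exists_ne (0 : E)
  exact ⟨span_orbit_eq_top ρ hv ▸ Submodule.fg_span (Set.finite_range _)⟩

variable {ρ}

/-- Schur's lemma. -/
lemma exists_eq_smul_of_commute [IsAlgClosed k] [FiniteDimensional k E] [ρ.IsIrreducible]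
    {A : Module.End k E} (hA : ∀ g v, A (ρ g v) = ρ g (A v)) : ∃ c : k, ∀ v, A v = c • v := by
  obtain ⟨c, hc⟩ :=
    (Representation.IsIrreducible.algebraMap_intertwiningMap_bijective_of_isAlgClosed (ρ := ρ)).2
      (A.intertwiningMap_of_isIntertwiningMap _ _ hA)
  exact ⟨c, fun v => (DFunLike.congr_fun hc v).symm⟩

variable (ρ)

lemma asAlgebraHom_mem_span_range (r : k[G]) :
    ρ.asAlgebraHom r ∈ Submodule.span k (Set.range ρ) := by
  induction r using MonoidAlgebra.induction_linear with
  | zero => simp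
  | add r s hr hs => rw [map_add]; exact add_mem hr hs
  | single g c =>
    rw [Representation.asAlgebraHom_single]
    exact Submodule.smul_mem _ _ (Submodule.subset_span ⟨g, rfl⟩)

/-- Burnside's theorem. -/
lemma span_range_eq_top [IsAlgClosed k] [FiniteDimensional k E] [ρ.IsIrreducible] :
    Submodule.span k (Set.range ρ) = ⊤ := by
  classical
  refine eq_top_iff.2 fun A _ => ?_
  let f : Module.End (Module.End k[G] ρ.asModule) ρ.asModule :=
    { ρ.asModuleEquiv.symm.toLinearMap ∘ₗ A ∘ₗ ρ.asModuleEquiv.toLinearMap with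
      map_smul' := fun T v => by
        obtain ⟨c, rfl⟩ := (IsSimpleModule.algebraMap_end_bijective_of_isAlgClosed k).2 T
        simp }
  obtain ⟨r, hr⟩ := jacobson_density f
    (Finset.univ.image (ρ.asModuleEquiv.symm ∘ Module.finBasis k E))
  have hA : A = ρ.asAlgebraHom r := (Module.finBasis k E).ext fun i => by
    have := hr _ (Finset.mem_image_of_mem _ (Finset.mem_univ i))
    simpa [f] using congrArg ρ.asModuleEquiv this
  exact hA ▸ asAlgebraHom_mem_span_range ρ r

end Irreducible

section Implements

variable {k G H E E' : Type*} [Field k] [Group G] [Monoid H] [AddCommGroup E] [Module k E]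
  [AddCommGroup E'] [Module k E'] {α : G → H → H} {π : Representation k H E}
  {π' : Representation k H E'} {ρ : Representation k G E} {ρ' : Representation k G E'}

/-- The operators `ρ g` implement the maps `α g` in the representation `π`: this is the relation
`ρ g ∘ π h ∘ (ρ g)⁻¹ = π (α g h)`, written without inverses. -/
def Implements (α : G → H → H) (π : Representation k H E) (ρ : Representation k G E) : Prop :=
  ∀ g h v, ρ g (π h v) = π (α g h) (ρ g v)

namespace Implements

lemma inv_apply (hρ : Implements α π ρ) (g : G) (h : H) (v : E) :
    ρ g⁻¹ (π (α g h) v) = π h (ρ g⁻¹ v) := by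
  have hv := congrArg (ρ g⁻¹) (hρ g h (ρ g⁻¹ v))
  simpa using hv.symm

variable [IsAlgClosed k] [FiniteDimensional k E] [π.IsIrreducible]

lemma exists_eq_smul (hρ : Implements α π ρ) (hρ' : Implements α π' ρ') (T : π'.Equiv π) (g : G) :
    ∃ c : k, ∀ x, T (ρ' g x) = c • ρ g (T x) := by
  have hT h x : T (π' h x) = π h (T x) :=
    Representation.IntertwiningMap.isIntertwining _ _ T.toIntertwiningMap h x
  have hT' h y : T.symm (π h y) = π' h (T.symm y) :=
    Representation.IntertwiningMap.isIntertwining _ _ T.symm.toIntertwiningMap h y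
  let A : Module.End k E :=
    ρ g⁻¹ ∘ₗ T.toLinearEquiv.toLinearMap ∘ₗ ρ' g ∘ₗ T.symm.toLinearEquiv.toLinearMap
  have hA y : A y = ρ g⁻¹ (T (ρ' g (T.symm y))) := rfl
  obtain ⟨c, hc⟩ := exists_eq_smul_of_commute (ρ := π) (A := A) fun h y => by
    rw [hA, hA, hT', hρ', hT, hρ.inv_apply]
  refine ⟨c, fun x => ?_⟩
  have hx := congrArg (ρ g) (hc (T x))
  simpa [hA] using hx

lemma exists_monoidHom (hρ : Implements α π ρ) (hρ' : Implements α π' ρ') (T : π'.Equiv π) :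
    ∃ χ : G →* k, ∀ g x, T (ρ' g x) = χ g • ρ g (T x) := by
  have := nontrivial_of_isIrreducible π
  obtain ⟨v, hv⟩ := exists_ne (0 : E)
  obtain ⟨x, rfl⟩ := T.toLinearEquiv.surjective v
  choose χ hχ using hρ.exists_eq_smul hρ' T
  have hinj (g : G) : Function.Injective fun c : k => c • ρ g (T x) :=
    smul_left_injective k ((map_ne_zero_iff _ (ρ.apply_bijective g).1).2 hv)
  refine ⟨{ toFun := χ, map_one' := hinj 1 ?_, map_mul' := fun a b => hinj (a * b) ?_ }, hχ⟩
  · exact (hχ 1 x).symm.trans (by simp)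
  · calc χ (a * b) • ρ (a * b) (T x) = T (ρ' a (ρ' b x)) := by
          rw [← hχ, map_mul, Module.End.mul_apply]
      _ = (χ a * χ b) • ρ (a * b) (T x) := by
          rw [hχ, hχ, map_smul, smul_smul, map_mul, Module.End.mul_apply]

end Implements

end Implements

section HeisenbergRep

variable {F W : Type*} [Field F] [AddCommGroup W] [Module F W] {B : LinearMap.BilinForm F W}

instance Heisenberg.instFinite [Finite F] [Finite W] : Finite (Heisenberg B) :=
  Finite.of_injective (fun h => (h.vec, h.cen)) fun h k e => by
    simp only [Prod.mk.injEq] at e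
    exact Heisenberg.ext e.1 e.2

lemma Heisenberg.eq_central_mul (h : Heisenberg B) :
    h = (⟨0, h.cen⟩ : Heisenberg B) * ⟨h.vec, 0⟩ := by
  ext <;> simp

variable {ψ : AddChar F ℂ} {E E' : Type*} [AddCommGroup E] [Module ℂ E]
  [AddCommGroup E'] [Module ℂ E'] {π : Representation ℂ (Heisenberg B) E}
  {π' : Representation ℂ (Heisenberg B) E'}

/-- The centre of the Heisenberg group acts through the character `ψ`. -/
def HasCentralChar (ψ : AddChar F ℂ) (π : Representation ℂ (Heisenberg B) E) : Prop :=
  ∀ (z : F) (v : E), π ⟨0, z⟩ v = ψ z • v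

namespace HasCentralChar

lemma apply (hc : HasCentralChar ψ π) (h : Heisenberg B) (v : E) :
    π h v = ψ h.cen • π ⟨h.vec, 0⟩ v := by
  conv_lhs => rw [h.eq_central_mul, map_mul, Module.End.mul_apply, hc]

lemma vec_mul (hc : HasCentralChar ψ π) (a b : W) (v : E) :
    π ⟨a, 0⟩ (π ⟨b, 0⟩ v) = ψ (2⁻¹ * B a b) • π ⟨a + b, 0⟩ v := by
  rw [← Module.End.mul_apply, ← map_mul, hc.apply]
  simp

lemma neg_vec (hc : HasCentralChar ψ π) (hB : B.IsAlt) (a : W) (v : E) :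
    π ⟨-a, 0⟩ (π ⟨a, 0⟩ v) = v := by
  rw [hc.vec_mul]
  simp only [map_neg, LinearMap.neg_apply, hB.self_eq_zero, neg_zero, mul_zero,
    AddChar.map_zero_eq_one, one_smul, neg_add_cancel]
  simpa using hc 0 v

lemma vec_comm [NeZero (2 : F)] (hc : HasCentralChar ψ π) (hB : B.IsAlt) (a b : W) (v : E) :
    π ⟨a, 0⟩ (π ⟨b, 0⟩ v) = ψ (B a b) • π ⟨b, 0⟩ (π ⟨a, 0⟩ v) := by
  rw [hc.vec_mul, hc.vec_mul, smul_smul, ← AddChar.map_add_eq_mul, add_comm b a, ← hB.neg_eq a b]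
  congr 2
  field_simp [NeZero.ne (2 : F)]
  ring

lemma conj_vec [NeZero (2 : F)] (hc : HasCentralChar ψ π) (hB : B.IsAlt) (a b : W) :
    π ⟨a, 0⟩ * π ⟨b, 0⟩ * π ⟨-a, 0⟩ = ψ (B a b) • π ⟨b, 0⟩ := by
  ext v
  have ha : π ⟨a, 0⟩ (π ⟨-a, 0⟩ v) = v := by simpa using hc.neg_vec hB (-a) v
  simp only [Module.End.mul_apply, LinearMap.smul_apply, hc.vec_comm hB a b, ha]

end HasCentralChar

/-- The character `a ↦ ψ (B a w)` of `W`. -/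
def formChar (ψ : AddChar F ℂ) (B : LinearMap.BilinForm F W) (w : W) : AddChar W ℂ :=
  ψ.compAddMonoidHom (B.flip w).toAddMonoidHom

@[simp] lemma formChar_apply (a w : W) : formChar ψ B w a = ψ (B a w) := rfl

lemma formChar_injective (hψ : ψ ≠ 1) (hB : B.SeparatingRight) :
    Function.Injective (formChar ψ B) := by
  intro w w' h
  refine sub_eq_zero.1 (hB _ fun a => ?_)
  by_contra ha
  refine hψ (DFunLike.ext _ _ fun z => ?_)
  have hz := DFunLike.congr_fun h ((z / B a (w - w')) • a)
  have hz' : B ((z / B a (w - w')) • a) w = z + B ((z / B a (w - w')) • a) w' := by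
    rw [← sub_eq_iff_eq_add, ← map_sub, map_smul, LinearMap.smul_apply, smul_eq_mul,
      div_mul_cancel₀ _ ha]
  rw [formChar_apply, formChar_apply, hz', AddChar.map_add_eq_mul] at hz
  exact mul_right_cancel₀ (ψ.val_isUnit _).ne_zero (hz.trans (one_mul _).symm)

/-- Conjugating a relation between the operators `π (w, 0)` by `π (a, 0)` multiplies its
coefficients by `ψ (B a w)`, and these characters of `a` are linearly independent. -/
lemma HasCentralChar.linearIndependent [NeZero (2 : F)] [Finite W] [Nontrivial E]
    (hc : HasCentralChar ψ π) (hψ : ψ ≠ 1) (hB : B.IsAlt) (hnd : B.SeparatingRight) :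
    LinearIndependent ℂ fun w : W => π ⟨w, 0⟩ := by
  rw [linearIndependent_iff']
  intro s f hf w hw
  have hconj (a : W) : ∑ w ∈ s, formChar ψ B w a • f w • π ⟨w, 0⟩ = 0 := by
    have h := congrArg (fun T => π ⟨a, 0⟩ * T * π ⟨-a, 0⟩) hf
    simp only [Finset.mul_sum, Finset.sum_mul, mul_smul_comm, smul_mul_assoc, hc.conj_vec hB,
      mul_zero, zero_mul] at h
    simpa only [formChar_apply, smul_comm (ψ _)] using h
  have hzero : f w • π ⟨w, 0⟩ = 0 := by
    refine (Module.forall_dual_apply_eq_zero_iff ℂ _).1 fun φ => ?_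
    have hli := (AddChar.linearIndependent W ℂ).comp _ (formChar_injective hψ hnd)
    refine linearIndependent_iff'.1 hli s (fun w => φ (f w • π ⟨w, 0⟩)) ?_ w hw
    ext a
    have h := congrArg φ (hconj a)
    simp only [map_sum, map_smul φ, map_zero] at h
    simpa [mul_comm] using h
  refine (smul_eq_zero.1 hzero).resolve_right fun h0 => ?_
  obtain ⟨v, hv⟩ := exists_ne (0 : E)
  exact hv (by rw [← hc.neg_vec hB w v, h0, LinearMap.zero_apply, map_zero])

lemma HasCentralChar.card_le_finrank_sq [NeZero (2 : F)] [Finite W] [FiniteDimensional ℂ E]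
    [Nontrivial E] (hc : HasCentralChar ψ π) (hψ : ψ ≠ 1) (hB : B.IsAlt)
    (hnd : B.SeparatingRight) : Nat.card W ≤ Module.finrank ℂ E ^ 2 := by
  cases nonempty_fintype W
  rw [Nat.card_eq_fintype_card, sq, ← Module.finrank_linearMap]
  exact (hc.linearIndependent hψ hB hnd).fintype_card_le_finrank

lemma IsHeisenbergRep.finiteDimensional [Finite F] [Finite W] (hπ : IsHeisenbergRep ψ π) :
    FiniteDimensional ℂ E :=
  have := hπ.irreducible
  finiteDimensional_of_isIrreducible π

lemma IsHeisenbergRep.nontrivial (hπ : IsHeisenbergRep ψ π) : Nontrivial E :=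
  have := hπ.irreducible
  nontrivial_of_isIrreducible π

lemma IsHeisenbergRep.hasCentralChar (hπ : IsHeisenbergRep ψ π) : HasCentralChar ψ π :=
  hπ.central

lemma IsHeisenbergRep.finrank_sq_eq_card [NeZero (2 : F)] [Finite F] [Finite W]
    (hπ : IsHeisenbergRep ψ π) (hψ : ψ ≠ 1) (hB : B.IsAlt) (hnd : B.SeparatingRight) :
    Module.finrank ℂ E ^ 2 = Nat.card W := by
  have := hπ.irreducible
  have := hπ.finiteDimensional
  have := hπ.nontrivial
  have hspan : ⊤ ≤ Submodule.span ℂ (Set.range fun w : W => π ⟨w, 0⟩) := by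
    rw [← span_range_eq_top π, Submodule.span_le]
    rintro _ ⟨h, rfl⟩
    rw [show π h = ψ h.cen • π ⟨h.vec, 0⟩ from LinearMap.ext (hπ.hasCentralChar.apply h)]
    exact Submodule.smul_mem _ _ (Submodule.subset_span ⟨h.vec, rfl⟩)
  rw [sq, ← Module.finrank_linearMap ℂ ℂ, Module.finrank_eq_nat_card_basis
    (.mk (hπ.hasCentralChar.linearIndependent hψ hB hnd) hspan)]

lemma HasCentralChar.isHeisenbergRep_of_finrank_sq_eq_card [NeZero (2 : F)] [Finite W]
    (hc : HasCentralChar ψ π) (hψ : ψ ≠ 1) (hB : B.IsAlt) (hnd : B.SeparatingRight)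
    (hcard : Module.finrank ℂ E ^ 2 = Nat.card W) : IsHeisenbergRep ψ π := by
  have hpos : 0 < Module.finrank ℂ E := by
    have := Nat.card_pos (α := W)
    exact Nat.pos_of_ne_zero fun h => by simp [h] at hcard; omega
  have := FiniteDimensional.of_finrank_pos hpos
  have := Module.nontrivial_of_finrank_pos hpos
  refine ⟨isIrreducible_of_forall_subrepresentation π fun N hN => ?_, hc⟩
  have := Submodule.nontrivial_iff_ne_bot.2 hN
  have hcN : HasCentralChar ψ N.toRepresentation := fun z v => Subtype.ext (hc z v)
  have hle := hcard ▸ hcN.card_le_finrank_sq hψ hB hnd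
  exact Submodule.eq_top_of_finrank_eq
    (le_antisymm (Submodule.finrank_le _) ((Nat.pow_le_pow_iff_left two_ne_zero).1 hle))

/-- The average of an operator under the action of `W` by conjugation. -/
def heisenbergAverage [Fintype W] (π : Representation ℂ (Heisenberg B) E)
    (π' : Representation ℂ (Heisenberg B) E') (A : E →ₗ[ℂ] E') : E →ₗ[ℂ] E' :=
  ∑ w : W, π' ⟨w, 0⟩ ∘ₗ A ∘ₗ π ⟨-w, 0⟩

lemma heisenbergAverage_apply [Fintype W] (A : E →ₗ[ℂ] E') (x : E) :
    heisenbergAverage π π' A x = ∑ w, π' ⟨w, 0⟩ (A (π ⟨-w, 0⟩ x)) := by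
  simp [heisenbergAverage, LinearMap.sum_apply]

lemma heisenbergAverage_comm [Fintype W] (hc : HasCentralChar ψ π) (hc' : HasCentralChar ψ π')
    (hB : B.IsAlt) (A : E →ₗ[ℂ] E') (h : Heisenberg B) (x : E) :
    heisenbergAverage π π' A (π h x) = π' h (heisenbergAverage π π' A x) := by
  rw [hc.apply, hc'.apply, map_smul]
  congr 1
  simp only [heisenbergAverage_apply, map_sum]
  rw [← Equiv.sum_comp (Equiv.addLeft h.vec)]
  refine Finset.sum_congr rfl fun w _ => ?_
  have hform : B (-(h.vec + w)) h.vec = B h.vec w := by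
    rw [map_neg, map_add, LinearMap.neg_apply, LinearMap.add_apply, hB.self_eq_zero,
      ← hB.neg_eq h.vec w]
    ring
  rw [Equiv.coe_addLeft, hc.vec_mul, hc'.vec_mul, hform, map_smul, map_smul,
    show -(h.vec + w) + h.vec = -w by abel]

lemma exists_heisenbergAverage_ne_zero [NeZero (2 : F)] [Fintype W] [Nontrivial E] [Nontrivial E']
    (hc : HasCentralChar ψ π) (hc' : HasCentralChar ψ π') (hψ : ψ ≠ 1) (hB : B.IsAlt)
    (hnd : B.SeparatingRight) : ∃ A, heisenbergAverage π π' A ≠ 0 := by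
  obtain ⟨x, hx⟩ := exists_ne (0 : E)
  obtain ⟨ξ, hξ⟩ : ∃ ξ : Module.Dual ℂ E, ξ x ≠ 0 := by
    by_contra! h
    exact hx ((Module.forall_dual_apply_eq_zero_iff ℂ x).1 h)
  by_contra! h
  have hrel : ∑ w : W, ξ (π ⟨-w, 0⟩ x) • π' ⟨w, 0⟩ = 0 := by
    ext y
    have hy := LinearMap.congr_fun (h (ξ.smulRight y)) x
    simpa [heisenbergAverage_apply] using hy
  refine hξ ?_
  simpa [hc 0 x] using
    Fintype.linearIndependent_iff.1 (hc'.linearIndependent hψ hB hnd) _ hrel 0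

/-- The Stone–von Neumann theorem. -/
theorem IsHeisenbergRep.nonempty_equiv [NeZero (2 : F)] [Finite W] (hπ : IsHeisenbergRep ψ π)
    (hπ' : IsHeisenbergRep ψ π') (hψ : ψ ≠ 1) (hB : B.IsAlt) (hnd : B.SeparatingRight) :
    Nonempty (π.Equiv π') := by
  cases nonempty_fintype W
  have := hπ.irreducible
  have := hπ'.irreducible
  have := hπ.nontrivial
  have := hπ'.nontrivial
  obtain ⟨A, hA⟩ :=
    exists_heisenbergAverage_ne_zero hπ.hasCentralChar hπ'.hasCentralChar hψ hB hnd
  let T : π.IntertwiningMap π' := (heisenbergAverage π π' A).intertwiningMap_of_isIntertwiningMap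
    _ _ (heisenbergAverage_comm hπ.hasCentralChar hπ'.hasCentralChar hB A)
  rcases Representation.IsIrreducible.bijective_or_eq_zero T with hT | hT
  · exact ⟨T.ofBijective hT⟩
  · exact absurd (congrArg Representation.IntertwiningMap.toLinearMap hT) hA

end HeisenbergRep

section OrthogonalSum

variable {F W W₁ W₂ : Type*} [Field F] [AddCommGroup W] [Module F W]
  [AddCommGroup W₁] [Module F W₁] [AddCommGroup W₂] [Module F W₂]
  {B : LinearMap.BilinForm F W} {B₁ : LinearMap.BilinForm F W₁} {B₂ : LinearMap.BilinForm F W₂}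
  {E₁ E₂ : Type*} [AddCommGroup E₁] [Module ℂ E₁] [AddCommGroup E₂] [Module ℂ E₂]
  {ψ : AddChar F ℂ} {π₁ : Representation ℂ (Heisenberg B₁) E₁}
  {π₂ : Representation ℂ (Heisenberg B₂) E₂} {e : W ≃ₗ[F] W₁ × W₂}

/-- The isomorphism `e` presents `(W, B)` as the orthogonal sum of `(W₁, B₁)` and `(W₂, B₂)`. -/
def IsOrthogonalSum (e : W ≃ₗ[F] W₁ × W₂) (B : LinearMap.BilinForm F W)
    (B₁ : LinearMap.BilinForm F W₁) (B₂ : LinearMap.BilinForm F W₂) : Prop :=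
  ∀ x y, B x y = B₁ (e x).1 (e y).1 + B₂ (e x).2 (e y).2

lemma IsOrthogonalSum.isAlt (he : IsOrthogonalSum e B B₁ B₂) (hB₁ : B₁.IsAlt) (hB₂ : B₂.IsAlt) :
    B.IsAlt := fun x => by
  rw [he, hB₁.self_eq_zero, hB₂.self_eq_zero, add_zero]

lemma IsOrthogonalSum.isSymm (he : IsOrthogonalSum e B B₁ B₂) (hB₁ : B₁.IsSymm)
    (hB₂ : B₂.IsSymm) : B.IsSymm :=
  ⟨fun x y => by rw [he, he, hB₁.eq, hB₂.eq]⟩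

lemma IsOrthogonalSum.separatingRight (he : IsOrthogonalSum e B B₁ B₂)
    (hnd₁ : B₁.SeparatingRight) (hnd₂ : B₂.SeparatingRight) : B.SeparatingRight := by
  intro w hw
  have h₁ : (e w).1 = 0 := hnd₁ _ fun x => by simpa [he _ _] using hw (e.symm (x, 0))
  have h₂ : (e w).2 = 0 := hnd₂ _ fun x => by simpa [he _ _] using hw (e.symm (0, x))
  exact e.map_eq_zero_iff.1 (Prod.ext h₁ h₂)

/-- The representation `(w₁, w₂, z) ↦ ψ z • π₁ (w₁, 0) ⊗ π₂ (w₂, 0)` of the Heisenberg group of an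
orthogonal sum. -/
def heisenbergTensor (he : IsOrthogonalSum e B B₁ B₂) (hc₁ : HasCentralChar ψ π₁)
    (hc₂ : HasCentralChar ψ π₂) : Representation ℂ (Heisenberg B) (E₁ ⊗[ℂ] E₂) where
  toFun h := ψ h.cen • TensorProduct.map (π₁ ⟨(e h.vec).1, 0⟩) (π₂ ⟨(e h.vec).2, 0⟩)
  map_one' := by
    have h₁ : π₁ ⟨0, 0⟩ = 1 := map_one π₁
    have h₂ : π₂ ⟨0, 0⟩ = 1 := map_one π₂
    simp [h₁, h₂]
  map_mul' h k := by
    ext x y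
    simp only [TensorProduct.AlgebraTensorModule.curry_apply, LinearMap.restrictScalars_self,
      TensorProduct.curry_apply, LinearMap.smul_apply, TensorProduct.map_tmul,
      Module.End.mul_apply, map_smul, hc₁.vec_mul, hc₂.vec_mul, TensorProduct.smul_tmul',
      TensorProduct.tmul_smul, smul_smul, Heisenberg.mul_vec, Heisenberg.mul_cen, map_add, he _ _,
      mul_add, AddChar.map_add_eq_mul, Prod.fst_add, Prod.snd_add]
    congr 1
    ac_rfl

section

variable (he : IsOrthogonalSum e B B₁ B₂) (hc₁ : HasCentralChar ψ π₁) (hc₂ : HasCentralChar ψ π₂)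

lemma heisenbergTensor_tmul (h : Heisenberg B) (x : E₁) (y : E₂) :
    heisenbergTensor he hc₁ hc₂ h (x ⊗ₜ y) =
      ψ h.cen • π₁ ⟨(e h.vec).1, 0⟩ x ⊗ₜ π₂ ⟨(e h.vec).2, 0⟩ y := rfl

lemma hasCentralChar_heisenbergTensor : HasCentralChar ψ (heisenbergTensor he hc₁ hc₂) := by
  intro z v
  have h₁ : π₁ ⟨0, 0⟩ = 1 := map_one π₁
  have h₂ : π₂ ⟨0, 0⟩ = 1 := map_one π₂
  simp [heisenbergTensor, h₁, h₂]

end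

lemma isHeisenbergRep_heisenbergTensor [NeZero (2 : F)] [Finite F] [Finite W]
    (he : IsOrthogonalSum e B B₁ B₂) (hπ₁ : IsHeisenbergRep ψ π₁) (hπ₂ : IsHeisenbergRep ψ π₂)
    (hψ : ψ ≠ 1) (hB₁ : B₁.IsAlt) (hnd₁ : B₁.SeparatingRight) (hB₂ : B₂.IsAlt)
    (hnd₂ : B₂.SeparatingRight) :
    IsHeisenbergRep ψ (heisenbergTensor he hπ₁.hasCentralChar hπ₂.hasCentralChar) := by
  have : Finite (W₁ × W₂) := .of_equiv W e.toEquiv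
  have : Finite W₁ := .of_surjective _ (Prod.fst_surjective (α := W₁) (β := W₂))
  have : Finite W₂ := .of_surjective _ (Prod.snd_surjective (α := W₁) (β := W₂))
  refine HasCentralChar.isHeisenbergRep_of_finrank_sq_eq_card
    (hasCentralChar_heisenbergTensor he _ _) hψ (he.isAlt hB₁ hB₂) (he.separatingRight hnd₁ hnd₂) ?_
  rw [Module.finrank_tensorProduct, mul_pow, hπ₁.finrank_sq_eq_card hψ hB₁ hnd₁,
    hπ₂.finrank_sq_eq_card hψ hB₂ hnd₂, Nat.card_congr e.toEquiv, Nat.card_prod]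

lemma Implements.tprod {G : Type*} [Group G] {φ : G →* SpGroup B} {φ₁ : G →* SpGroup B₁}
    {φ₂ : G →* SpGroup B₂} {ρ₁ : Representation ℂ G E₁} {ρ₂ : Representation ℂ G E₂}
    (he : IsOrthogonalSum e B B₁ B₂) (hc₁ : HasCentralChar ψ π₁) (hc₂ : HasCentralChar ψ π₂)
    (hρ₁ : Implements (fun g => Heisenberg.act (φ₁ g)) π₁ ρ₁)
    (hρ₂ : Implements (fun g => Heisenberg.act (φ₂ g)) π₂ ρ₂)
    (hφ : ∀ g w, e ((φ g : W ≃ₗ[F] W) w) =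
      ((φ₁ g : W₁ ≃ₗ[F] W₁) (e w).1, (φ₂ g : W₂ ≃ₗ[F] W₂) (e w).2)) :
    Implements (fun g => Heisenberg.act (φ g)) (heisenbergTensor he hc₁ hc₂) (ρ₁.tprod ρ₂) := by
  intro g h x
  induction x using TensorProduct.induction_on with
  | zero => simp
  | add x y hx hy => simp only [map_add, hx, hy]
  | tmul x y =>
    simp only [heisenbergTensor_tmul, map_smul, Representation.tprod_apply,
      TensorProduct.map_tmul, Heisenberg.act, hφ, hρ₁ g _ x, hρ₂ g _ y]

/-- By the Stone–von Neumann theorem the two representations are projectively equivalent. -/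
lemma Implements.exists_equiv_tprod {G : Type*} [Group G] [NeZero (2 : F)] [Finite F] [Finite W]
    {E : Type*} [AddCommGroup E] [Module ℂ E] {π : Representation ℂ (Heisenberg B) E}
    {φ : G →* SpGroup B} {φ₁ : G →* SpGroup B₁} {φ₂ : G →* SpGroup B₂}
    {ρ : Representation ℂ G E} {ρ₁ : Representation ℂ G E₁} {ρ₂ : Representation ℂ G E₂}
    (he : IsOrthogonalSum e B B₁ B₂) (hπ : IsHeisenbergRep ψ π) (hπ₁ : IsHeisenbergRep ψ π₁)
    (hπ₂ : IsHeisenbergRep ψ π₂) (hψ : ψ ≠ 1) (hB₁ : B₁.IsAlt) (hnd₁ : B₁.SeparatingRight)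
    (hB₂ : B₂.IsAlt) (hnd₂ : B₂.SeparatingRight)
    (hρ : Implements (fun g => Heisenberg.act (φ g)) π ρ)
    (hρ₁ : Implements (fun g => Heisenberg.act (φ₁ g)) π₁ ρ₁)
    (hρ₂ : Implements (fun g => Heisenberg.act (φ₂ g)) π₂ ρ₂)
    (hφ : ∀ g w, e ((φ g : W ≃ₗ[F] W) w) =
      ((φ₁ g : W₁ ≃ₗ[F] W₁) (e w).1, (φ₂ g : W₂ ≃ₗ[F] W₂) (e w).2)) :
    ∃ (T : (heisenbergTensor he hπ₁.hasCentralChar hπ₂.hasCentralChar).Equiv π) (χ : G →* ℂ),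
      ∀ g x, T (ρ₁.tprod ρ₂ g x) = χ g • ρ g (T x) := by
  have := hπ.irreducible
  have := hπ.finiteDimensional
  obtain ⟨T⟩ := (isHeisenbergRep_heisenbergTensor he hπ₁ hπ₂ hψ hB₁ hnd₁ hB₂ hnd₂).nonempty_equiv
    hπ hψ (he.isAlt hB₁ hB₂) (he.separatingRight hnd₁ hnd₂)
  exact ⟨T, hρ.exists_monoidHom (.tprod he _ _ hρ₁ hρ₂ hφ) T⟩

end OrthogonalSum

section FixedSpace

variable {F W : Type*} [Field F] [AddCommGroup W] [Module F W] {B : LinearMap.BilinForm F W}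
  {ψ : AddChar F ℂ} {E : Type*} [AddCommGroup E] [Module ℂ E]
  {π : Representation ℂ (Heisenberg B) E} {L : Submodule F W}

/-- A Lagrangian subspace, defined as one which equals its orthogonal. -/
def IsLagrangian (B : LinearMap.BilinForm F W) (L : Submodule F W) : Prop :=
  B.orthogonal L = L

lemma IsLagrangian.mem_iff (hL : IsLagrangian B L) {w : W} : w ∈ L ↔ ∀ l ∈ L, B l w = 0 := by
  conv_lhs => rw [← hL]
  exact LinearMap.BilinForm.mem_orthogonal_iff

/-- The space of vectors fixed by the operators `π (l, 0)` for `l` in `L`. -/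
def fixedSpace (π : Representation ℂ (Heisenberg B) E) (L : Submodule F W) : Submodule ℂ E where
  carrier := {v | ∀ l ∈ L, π ⟨l, 0⟩ v = v}
  zero_mem' l _ := map_zero _
  add_mem' hx hy l hl := by rw [map_add, hx l hl, hy l hl]
  smul_mem' c x hx l hl := by rw [map_smul, hx l hl]

/-- The sum of the operators `π (l, 0)` for `l` in `L`. -/
def fixedSum (π : Representation ℂ (Heisenberg B) E) (L : Submodule F W) [Fintype L] :
    Module.End ℂ E :=
  ∑ l : L, π ⟨l, 0⟩

lemma fixedSum_apply [Fintype L] (v : E) : fixedSum π L v = ∑ l : L, π ⟨l, 0⟩ v :=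
  LinearMap.sum_apply ..

lemma fixedSum_apply_of_mem_fixedSpace [Fintype L] {v : E} (hv : v ∈ fixedSpace π L) :
    fixedSum π L v = (Fintype.card L : ℂ) • v := by
  have hl (l : L) : π ⟨l, 0⟩ v = v := hv l l.2
  simp [fixedSum_apply, hl, Nat.cast_smul_eq_nsmul]

lemma fixedSum_apply_mem_fixedSpace [Fintype L] (hc : HasCentralChar ψ π) (hL : IsLagrangian B L)
    (v : E) : fixedSum π L v ∈ fixedSpace π L := by
  intro a ha
  have hmul (l : L) : π ⟨a, 0⟩ (π ⟨l, 0⟩ v) = π ⟨a + l, 0⟩ v := by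
    rw [hc.vec_mul, hL.mem_iff.1 l.2 a ha, mul_zero, AddChar.map_zero_eq_one, one_smul]
  simp only [fixedSum_apply, map_sum, hmul]
  exact Equiv.sum_comp (Equiv.addLeft (⟨a, ha⟩ : L)) fun l : L => π ⟨l, 0⟩ v

lemma exists_mem_fixedSpace_ne_zero [NeZero (2 : F)] [Finite W] [Nontrivial E]
    (hc : HasCentralChar ψ π) (hψ : ψ ≠ 1) (hB : B.IsAlt) (hnd : B.SeparatingRight)
    (hL : IsLagrangian B L) : ∃ v ∈ fixedSpace π L, v ≠ 0 := by
  cases nonempty_fintype L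
  obtain ⟨v, hv⟩ : ∃ v, fixedSum π L v ≠ 0 := by
    by_contra! h
    have hsum : ∑ l : L, (1 : ℂ) • π ⟨l, 0⟩ = 0 := by
      simpa only [one_smul] using LinearMap.ext h
    have hli := (hc.linearIndependent hψ hB hnd).comp ((↑) : L → W) Subtype.val_injective
    exact one_ne_zero (Fintype.linearIndependent_iff.1 hli _ hsum 0)
  exact ⟨_, fixedSum_apply_mem_fixedSpace hc hL v, hv⟩

lemma fixedSum_vec_eq_zero [NeZero (2 : F)] [Fintype L] (hc : HasCentralChar ψ π) (hψ : ψ ≠ 1)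
    (hB : B.IsAlt) {v : E} (hv : v ∈ fixedSpace π L) {w : W} (hw : ∃ l ∈ L, B l w ≠ 0) :
    fixedSum π L (π ⟨w, 0⟩ v) = 0 := by
  obtain ⟨l₀, hl₀, hw⟩ := hw
  have hchar : (formChar ψ B w).compAddMonoidHom L.subtype.toAddMonoidHom ≠ 0 := fun h => by
    refine hψ (DFunLike.ext _ _ fun z => ?_)
    have hz := DFunLike.congr_fun h (⟨(z / B l₀ w) • l₀, L.smul_mem _ hl₀⟩ : L)
    simpa [div_mul_cancel₀ _ hw] using hz
  have hsum : ∑ l : L, ψ (B l w) = 0 := AddChar.sum_eq_zero_iff_ne_zero.2 hchar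
  have hcomm (l : L) : π ⟨l, 0⟩ (π ⟨w, 0⟩ v) = ψ (B l w) • π ⟨w, 0⟩ v := by
    rw [hc.vec_comm hB, hv l l.2]
  simp only [fixedSum_apply, hcomm]
  rw [← Finset.sum_smul, hsum, zero_smul]

/-- Summing over `L` maps the orbit of `v`, hence the whole space, to the line spanned by `v`. -/
lemma fixedSpace_le_span_singleton [NeZero (2 : F)] [Finite W] (hπ : IsHeisenbergRep ψ π)
    (hψ : ψ ≠ 1) (hB : B.IsAlt) (hL : IsLagrangian B L) {v : E} (hv : v ∈ fixedSpace π L)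
    (hv₀ : v ≠ 0) : fixedSpace π L ≤ Submodule.span ℂ {v} := by
  cases nonempty_fintype L
  have := hπ.irreducible
  have hrange : ⊤ ≤ (Submodule.span ℂ {v}).comap (fixedSum π L) := by
    rw [← span_orbit_eq_top π hv₀, Submodule.span_le]
    rintro _ ⟨h, rfl⟩
    change fixedSum π L (π h v) ∈ Submodule.span ℂ {v}
    rw [hπ.hasCentralChar.apply, map_smul]
    refine Submodule.smul_mem _ _ ?_
    by_cases hw : h.vec ∈ L
    · rw [hv _ hw, fixedSum_apply_of_mem_fixedSpace hv]
      exact Submodule.smul_mem _ _ (Submodule.mem_span_singleton_self v)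
    · rw [hL.mem_iff] at hw
      push Not at hw
      rw [fixedSum_vec_eq_zero hπ.hasCentralChar hψ hB hv hw]
      exact zero_mem _
  intro x hx
  have hcard : (Fintype.card L : ℂ) ≠ 0 := Nat.cast_ne_zero.2 Fintype.card_ne_zero
  rw [← Submodule.smul_mem_iff _ hcard, ← fixedSum_apply_of_mem_fixedSpace hx]
  exact hrange Submodule.mem_top

lemma Implements.mem_fixedSpace {ω : Representation ℂ (SpGroup B) E}
    (hω : Implements Heisenberg.act π ω) {v : E} (hv : v ∈ fixedSpace π L) {g : SpGroup B}
    (hg : L ≤ L.map (g : W ≃ₗ[F] W).toLinearMap) : ω g v ∈ fixedSpace π L := by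
  intro l hl
  obtain ⟨l', hl', rfl⟩ := hg hl
  exact (hω g ⟨l', 0⟩ v).symm.trans (congrArg (ω g) (hv l' hl'))

/-- The stabilizer of a Lagrangian `L` acts on the line fixed by `L` through a character, which is
trivial on commutators. -/
lemma Implements.apply_eq_self_of_mul_eq [NeZero (2 : F)] [Finite W]
    {ω : Representation ℂ (SpGroup B) E} (hω : Implements Heisenberg.act π ω)
    (hπ : IsHeisenbergRep ψ π) (hψ : ψ ≠ 1) (hB : B.IsAlt) (hL : IsLagrangian B L)
    {g s u : SpGroup B} (hs : L ≤ L.map (s : W ≃ₗ[F] W).toLinearMap)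
    (hu : L ≤ L.map (u : W ≃ₗ[F] W).toLinearMap) (hg : s * u = g * (u * s)) {v : E}
    (hv : v ∈ fixedSpace π L) : ω g v = v := by
  obtain rfl | hv₀ := eq_or_ne v 0
  · exact map_zero _
  have hle := fixedSpace_le_span_singleton hπ hψ hB hL hv hv₀
  obtain ⟨a, ha⟩ := Submodule.mem_span_singleton.1 (hle (hω.mem_fixedSpace hv hs))
  obtain ⟨b, hb⟩ := Submodule.mem_span_singleton.1 (hle (hω.mem_fixedSpace hv hu))
  have hsu : ω (s * u) v = (a * b) • v := by
    rw [map_mul, Module.End.mul_apply, ← hb, map_smul, ← ha, smul_smul, mul_comm]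
  have hus : ω (u * s) v = (a * b) • v := by
    rw [map_mul, Module.End.mul_apply, ← ha, map_smul, ← hb, smul_smul]
  have hab : (a * b) • v ≠ 0 := hsu ▸ (map_ne_zero_iff _ (ω.apply_bijective _).1).2 hv₀
  refine smul_right_injective E (left_ne_zero_of_smul hab) ?_
  calc (a * b) • ω g v = ω (g * (u * s)) v := by
        rw [map_mul, Module.End.mul_apply, hus, map_smul]
    _ = (a * b) • v := by rw [← hg, hsu]

lemma fixedSpace_le_comap {E' : Type*} [AddCommGroup E'] [Module ℂ E']
    {π' : Representation ℂ (Heisenberg B) E'} (T : π.Equiv π') :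
    fixedSpace π L ≤ (fixedSpace π' L).comap T.toLinearEquiv.toLinearMap := fun v hv l hl =>
  (Representation.IntertwiningMap.isIntertwining _ _ T.toIntertwiningMap ⟨l, 0⟩ v).symm.trans
    (congrArg T (hv l hl))

lemma tmul_mem_fixedSpace_heisenbergTensor {W₁ W₂ E₁ E₂ : Type*} [AddCommGroup W₁] [Module F W₁]
    [AddCommGroup W₂] [Module F W₂] [AddCommGroup E₁] [Module ℂ E₁] [AddCommGroup E₂]
    [Module ℂ E₂] {B₁ : LinearMap.BilinForm F W₁} {B₂ : LinearMap.BilinForm F W₂}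
    {π₁ : Representation ℂ (Heisenberg B₁) E₁} {π₂ : Representation ℂ (Heisenberg B₂) E₂}
    {e : W ≃ₗ[F] W₁ × W₂} (he : IsOrthogonalSum e B B₁ B₂) (hc₁ : HasCentralChar ψ π₁)
    (hc₂ : HasCentralChar ψ π₂) {L₁ : Submodule F W₁} {L₂ : Submodule F W₂}
    (hL : ∀ w ∈ L, e w ∈ L₁.prod L₂) {v₁ : E₁} (hv₁ : v₁ ∈ fixedSpace π₁ L₁) {v₂ : E₂}
    (hv₂ : v₂ ∈ fixedSpace π₂ L₂) :
    v₁ ⊗ₜ v₂ ∈ fixedSpace (heisenbergTensor he hc₁ hc₂) L := fun l hl => by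
  rw [heisenbergTensor_tmul, hv₁ _ (hL l hl).1, hv₂ _ (hL l hl).2, AddChar.map_zero_eq_one,
    one_smul]

end FixedSpace

section TensorForm

open Matrix.SpecialLinearGroup (transvection toLin')

variable {F U : Type*} [Field F] [AddCommGroup U] [Module F U] {β : LinearMap.BilinForm F U}

@[simp]
lemma tensorForm_tmul (x y : U) (v w : Fin 2 → F) :
    tensorForm β (x ⊗ₜ v) (y ⊗ₜ w) = sympV F v w * β x y := by
  simp [tensorForm]

@[simp]
lemma slToSp_tmul (g : Matrix.SpecialLinearGroup (Fin 2) F) (x : U) (v : Fin 2 → F) :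
    (slToSp β g : U ⊗[F] (Fin 2 → F) ≃ₗ[F] U ⊗[F] (Fin 2 → F)) (x ⊗ₜ v) = x ⊗ₜ toLin' g v := rfl

lemma spGroup_tensorForm_ext {g h : SpGroup (tensorForm β)}
    (H : ∀ x v, (g : U ⊗[F] (Fin 2 → F) ≃ₗ[F] U ⊗[F] (Fin 2 → F)) (x ⊗ₜ v) =
      (h : U ⊗[F] (Fin 2 → F) ≃ₗ[F] U ⊗[F] (Fin 2 → F)) (x ⊗ₜ v)) : g = h :=
  Subtype.ext (LinearEquiv.toLinearMap_injective (TensorProduct.ext' H))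

@[simp]
lemma sympV_self (v : Fin 2 → F) : sympV F v v = 0 := by
  rw [sympV_apply]; ring

lemma sympV_single_ne_zero {i j : Fin 2} (hij : i ≠ j) :
    sympV F (Pi.single i 1) (Pi.single j 1) ≠ 0 := by
  fin_cases i <;> fin_cases j <;> simp [sympV_apply] at hij ⊢

lemma exists_eq_tmul_add_tmul {i j : Fin 2} (hij : i ≠ j) (w : U ⊗[F] (Fin 2 → F)) :
    ∃ x y, w = x ⊗ₜ Pi.single i 1 + y ⊗ₜ Pi.single j 1 := by
  induction w using TensorProduct.induction_on with
  | zero => exact ⟨0, 0, by simp⟩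
  | add w w' hw hw' =>
    obtain ⟨x, y, rfl⟩ := hw
    obtain ⟨x', y', rfl⟩ := hw'
    exact ⟨x + x', y + y', by simp only [TensorProduct.add_tmul]; abel⟩
  | tmul x v =>
    refine ⟨v i • x, v j • x, ?_⟩
    rw [TensorProduct.smul_tmul, TensorProduct.smul_tmul, ← TensorProduct.tmul_add]
    congr 1
    ext k
    fin_cases i <;> fin_cases j <;> fin_cases k <;> simp at hij ⊢

lemma tensorForm_isAlt (hβ : β.IsSymm) : (tensorForm β).IsAlt := by
  intro w
  obtain ⟨x, y, rfl⟩ := exists_eq_tmul_add_tmul (zero_ne_one (α := Fin 2)) w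
  simp [sympV_apply, hβ.eq x y]

/-- The subspace `U ⊗ v` of `U ⊗ V`. -/
def tensorVec (U : Type*) [AddCommGroup U] [Module F U] (v : Fin 2 → F) :
    Submodule F (U ⊗[F] (Fin 2 → F)) :=
  LinearMap.range ((TensorProduct.mk F U (Fin 2 → F)).flip v)

lemma mem_tensorVec {v : Fin 2 → F} {w : U ⊗[F] (Fin 2 → F)} :
    w ∈ tensorVec U v ↔ ∃ x, x ⊗ₜ v = w := Iff.rfl

lemma isLagrangian_tensorVec (hβ : β.SeparatingRight) (i : Fin 2) :
    IsLagrangian (tensorForm β) (tensorVec U (Pi.single i 1)) := by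
  obtain ⟨j, hij⟩ := exists_ne i
  ext w
  simp only [LinearMap.BilinForm.mem_orthogonal_iff, mem_tensorVec, forall_exists_index,
    forall_apply_eq_imp_iff]
  refine ⟨fun h => ?_, fun ⟨x, hx⟩ y => by simp [← hx]⟩
  obtain ⟨x, y, rfl⟩ := exists_eq_tmul_add_tmul hij.symm w
  have hy : y = 0 := hβ y fun z => by simpa [sympV_single_ne_zero hij.symm] using h z
  exact ⟨x, by simp [hy]⟩

lemma tensorForm_separatingRight (hβ : β.SeparatingRight) : (tensorForm β).SeparatingRight := by
  intro w hw
  obtain ⟨x, rfl⟩ := mem_tensorVec.1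
    ((isLagrangian_tensorVec hβ 0).mem_iff.2 fun l _ => hw l)
  have hx : x = 0 := hβ x fun z => by
    simpa [sympV_single_ne_zero (zero_ne_one (α := Fin 2)).symm] using hw (z ⊗ₜ Pi.single 1 1)
  rw [hx, TensorProduct.zero_tmul]

section OrthogonalSum

variable {U₁ U₂ : Type*} [AddCommGroup U₁] [Module F U₁] [AddCommGroup U₂] [Module F U₂]
  {β₁ : LinearMap.BilinForm F U₁} {β₂ : LinearMap.BilinForm F U₂}

/-- The decomposition of `U ⊗ V` induced by a decomposition of `U`. -/
def tensorProdEquiv (e : U ≃ₗ[F] U₁ × U₂) :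
    U ⊗[F] (Fin 2 → F) ≃ₗ[F] (U₁ ⊗[F] (Fin 2 → F)) × (U₂ ⊗[F] (Fin 2 → F)) :=
  e.rTensor (Fin 2 → F) ≪≫ₗ TensorProduct.prodLeft F F U₁ U₂ (Fin 2 → F)

@[simp]
lemma tensorProdEquiv_tmul (e : U ≃ₗ[F] U₁ × U₂) (x : U) (v : Fin 2 → F) :
    tensorProdEquiv e (x ⊗ₜ v) = ((e x).1 ⊗ₜ v, (e x).2 ⊗ₜ v) := rfl

lemma isOrthogonalSum_tensorProdEquiv {e : U ≃ₗ[F] U₁ × U₂} (he : IsOrthogonalSum e β β₁ β₂) :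
    IsOrthogonalSum (tensorProdEquiv e) (tensorForm β) (tensorForm β₁) (tensorForm β₂) := by
  intro a b
  induction a using TensorProduct.induction_on with
  | zero => simp
  | add a a' ha ha' =>
    simp only [map_add, LinearMap.add_apply, Prod.fst_add, Prod.snd_add, ha, ha']
    ring
  | tmul x v =>
    induction b using TensorProduct.induction_on with
    | zero => simp
    | add b b' hb hb' =>
      simp only [map_add, Prod.fst_add, Prod.snd_add, hb, hb']
      ring
    | tmul y w => simp only [tensorProdEquiv_tmul, tensorForm_tmul, he x y, mul_add]

lemma tensorProdEquiv_slToSp (e : U ≃ₗ[F] U₁ × U₂) (g : Matrix.SpecialLinearGroup (Fin 2) F)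
    (w : U ⊗[F] (Fin 2 → F)) :
    tensorProdEquiv e ((slToSp β g : U ⊗[F] (Fin 2 → F) ≃ₗ[F] U ⊗[F] (Fin 2 → F)) w) =
      ((slToSp β₁ g : U₁ ⊗[F] (Fin 2 → F) ≃ₗ[F] U₁ ⊗[F] (Fin 2 → F)) (tensorProdEquiv e w).1,
        (slToSp β₂ g : U₂ ⊗[F] (Fin 2 → F) ≃ₗ[F] U₂ ⊗[F] (Fin 2 → F)) (tensorProdEquiv e w).2) := by
  induction w using TensorProduct.induction_on with
  | zero => simp only [map_zero, Prod.fst_zero, Prod.snd_zero, Prod.mk_zero_zero]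
  | add w w' hw hw' => simp only [map_add, hw, hw', Prod.fst_add, Prod.snd_add, Prod.mk_add_mk]
  | tmul x v => rfl

lemma tensorProdEquiv_mem_tensorVec (e : U ≃ₗ[F] U₁ × U₂) {v : Fin 2 → F}
    {w : U ⊗[F] (Fin 2 → F)} (hw : w ∈ tensorVec U v) :
    tensorProdEquiv e w ∈ (tensorVec U₁ v).prod (tensorVec U₂ v) := by
  obtain ⟨x, rfl⟩ := mem_tensorVec.1 hw
  exact ⟨⟨(e x).1, rfl⟩, ⟨(e x).2, rfl⟩⟩

end OrthogonalSum

lemma toLin'_transvection_apply {i j : Fin 2} (hij : i ≠ j) (c : F) (v : Fin 2 → F) :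
    toLin' (transvection hij c) v = v + Pi.single i (c * v j) := by
  ext k
  rw [Matrix.SpecialLinearGroup.toLin'_apply, Matrix.toLin'_apply,
    Matrix.SpecialLinearGroup.transvection_coe, Matrix.add_mulVec, Matrix.one_mulVec,
    Matrix.single_mulVec_eq]
  by_cases h : k = i
  · subst h; simp
  · simp [h]

lemma slToSp_transvection_apply {i j : Fin 2} (hij : i ≠ j) (c : F) {w : U ⊗[F] (Fin 2 → F)}
    (hw : w ∈ tensorVec U (Pi.single i 1)) :
    (slToSp β (transvection hij c) : U ⊗[F] (Fin 2 → F) ≃ₗ[F] U ⊗[F] (Fin 2 → F)) w = w := by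
  obtain ⟨x, rfl⟩ := mem_tensorVec.1 hw
  rw [slToSp_tmul, toLin'_transvection_apply]
  simp [hij.symm]

section Similitude

variable {μ : F}

/-- The tensor product of a similitude `A` of `U` of multiplier `μ` and the similitude
`diag(1, μ⁻¹)` of `V`, which has the inverse multiplier. -/
def similitude (hμ : μ ≠ 0) (A : U ≃ₗ[F] U) (hA : ∀ x y, β (A x) (A y) = μ * β x y) :
    SpGroup (tensorForm β) :=
  ⟨TensorProduct.congr A
    (LinearEquiv.piCongrRight ![.refl F F, .smulOfNeZero F F μ⁻¹ (inv_ne_zero hμ)]), by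
    intro a b
    induction a using TensorProduct.induction_on with
    | zero => simp
    | add a a' ha ha' => simp only [map_add, LinearMap.add_apply, ha, ha']
    | tmul x v =>
      induction b using TensorProduct.induction_on with
      | zero => simp
      | add b b' hb hb' => simp only [map_add, hb, hb']
      | tmul y w =>
        simp only [TensorProduct.congr_tmul, tensorForm_tmul, hA, sympV_apply,
          LinearEquiv.piCongrRight_apply, Matrix.cons_val_zero, LinearEquiv.refl_apply,
          Matrix.cons_val_one, Matrix.cons_val_fin_one, LinearEquiv.smulOfNeZero_apply, smul_eq_mul]
        field_simp⟩

variable {hμ : μ ≠ 0} {A : U ≃ₗ[F] U} {hA : ∀ x y, β (A x) (A y) = μ * β x y}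

lemma similitude_tmul (x : U) (v : Fin 2 → F) :
    (similitude hμ A hA : U ⊗[F] (Fin 2 → F) ≃ₗ[F] U ⊗[F] (Fin 2 → F)) (x ⊗ₜ v) =
      A x ⊗ₜ ![v 0, μ⁻¹ * v 1] := by
  change A x ⊗ₜ _ = _
  congr 1
  ext k
  fin_cases k <;> simp

lemma tensorVec_le_map_similitude (i : Fin 2) :
    tensorVec U (Pi.single i 1) ≤ (tensorVec U (Pi.single i 1)).map
      (similitude hμ A hA : U ⊗[F] (Fin 2 → F) ≃ₗ[F] U ⊗[F] (Fin 2 → F)).toLinearMap := by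
  intro w hw
  obtain ⟨x, rfl⟩ := mem_tensorVec.1 hw
  have hv : ∃ κ : F, κ ≠ 0 ∧ (![(Pi.single i 1 : Fin 2 → F) 0,
      μ⁻¹ * (Pi.single i 1 : Fin 2 → F) 1]) = κ • (Pi.single i 1 : Fin 2 → F) := by
    fin_cases i
    · exact ⟨1, one_ne_zero, by ext k; fin_cases k <;> simp⟩
    · exact ⟨μ⁻¹, inv_ne_zero hμ, by ext k; fin_cases k <;> simp⟩
  obtain ⟨κ, hκ, hv⟩ := hv
  refine ⟨A.symm (κ⁻¹ • x) ⊗ₜ Pi.single i 1, ⟨_, rfl⟩, ?_⟩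
  rw [LinearEquiv.coe_coe, similitude_tmul, hv, LinearEquiv.apply_symm_apply,
    TensorProduct.smul_tmul, smul_smul, inv_mul_cancel₀ hκ, one_smul]

lemma exists_similitude_mul_transvection (hμ₁ : μ ≠ 1) {i j : Fin 2} (hij : i ≠ j) (c : F) :
    ∃ c', similitude hμ A hA * slToSp β (transvection hij c') =
      slToSp β (transvection hij c) * (slToSp β (transvection hij c') * similitude hμ A hA) := by
  have h₁ : μ - 1 ≠ 0 := sub_ne_zero.2 hμ₁
  have h₂ : 1 - μ ≠ 0 := sub_ne_zero.2 hμ₁.symm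
  refine ⟨if i = 0 then c / (μ - 1) else c * μ / (1 - μ), spGroup_tensorForm_ext fun x v => ?_⟩
  simp only [Subgroup.coe_mul, LinearEquiv.mul_apply, slToSp_tmul, similitude_tmul,
    toLin'_transvection_apply]
  congr 1
  ext k
  fin_cases i <;> fin_cases j <;> fin_cases k <;>
    simp [Matrix.vecHead, Matrix.vecTail] at hij ⊢ <;> field_simp <;> ring

end Similitude

end TensorForm

section FiniteField

variable {F : Type*} [Field F]

lemma ringChar_ne_two [NeZero (2 : F)] : ringChar F ≠ 2 := fun h =>
  two_ne_zero (α := F) (by simpa only [h, Nat.cast_ofNat] using ringChar.Nat.cast_ringChar (R := F))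

variable [Finite F]

lemma two_ne_zero_of_odd_card (hF : Odd (Nat.card F)) : (2 : F) ≠ 0 := by
  cases nonempty_fintype F
  rw [Nat.card_eq_fintype_card, Nat.odd_iff] at hF
  refine Ring.two_ne_zero fun h => ?_
  have := FiniteField.even_card_of_char_two h
  omega

lemma isSquare_mul_of_not_isSquare {a b : F} (ha : ¬ IsSquare a) (hb : ¬ IsSquare b) :
    IsSquare (a * b) := by
  classical
  cases nonempty_fintype F
  have ha₀ : a ≠ 0 := by rintro rfl; exact ha .zero
  have hb₀ : b ≠ 0 := by rintro rfl; exact hb .zero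
  rw [← quadraticChar_one_iff_isSquare (mul_ne_zero ha₀ hb₀), map_mul,
    quadraticChar_neg_one_iff_not_isSquare.2 ha, quadraticChar_neg_one_iff_not_isSquare.2 hb]
  norm_num

lemma isSquare_neg_one_iff_card : IsSquare (-1 : F) ↔ Nat.card F % 4 ≠ 3 := by
  cases nonempty_fintype F
  rw [Nat.card_eq_fintype_card, FiniteField.isSquare_neg_one_iff]

variable [NeZero (2 : F)]

lemma exists_sq_ne_one (hF : Nat.card F ≠ 3) : ∃ a : F, a ≠ 0 ∧ a ^ 2 ≠ 1 := by
  cases nonempty_fintype F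
  by_contra! h
  have hdvd : Fintype.card F - 1 ∣ 2 := (FiniteField.forall_pow_eq_one_iff F 2).1 fun x =>
    Units.ext (h x x.ne_zero)
  have hodd := FiniteField.odd_card_of_char_ne_two (ringChar_ne_two (F := F))
  have hle := Nat.le_of_dvd two_pos hdvd
  rw [Nat.card_eq_fintype_card] at hF
  have := Fintype.one_lt_card (α := F)
  omega

lemma exists_mul_sq_add_mul_sq_eq {a b : F} (ha : a ≠ 0) (hb : b ≠ 0) (c : F) :
    ∃ s t : F, a * s ^ 2 + b * t ^ 2 = c := by
  cases nonempty_fintype F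
  obtain ⟨s, t, h⟩ := FiniteField.exists_root_sum_quadratic
    (f := .C a * .X ^ 2) (g := .C b * .X ^ 2 - .C c) (Polynomial.degree_C_mul_X_pow 2 ha)
    (by rw [Polynomial.degree_sub_C] <;> simp [Polynomial.degree_C_mul_X_pow 2 hb])
    (FiniteField.odd_card_of_char_ne_two ringChar_ne_two)
  exact ⟨s, t, by simpa [sub_eq_zero, ← add_sub_assoc] using h⟩

end FiniteField

section Normalized

open Matrix.SpecialLinearGroup (transvection)

variable {F U : Type*} [Field F] [AddCommGroup U] [Module F U] {β : LinearMap.BilinForm F U}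
  {ψ : AddChar F ℂ} {E : Type*} [AddCommGroup E] [Module ℂ E]

/-- The operators `ω` form an oscillator representation on the space of the Heisenberg
representation `π`, and the transvections of `V` fixing a coordinate vector `e` of `V` fix the
vectors which are fixed by `U ⊗ e`. As `SL₂(F)` is generated by these transvections, this
condition excludes twists by a character of `SL₂(F)`, also when `F` has three elements. -/
structure IsNormalizedOscillator (ψ : AddChar F ℂ)
    (π : Representation ℂ (Heisenberg (tensorForm β)) E)
    (ω : Representation ℂ (SpGroup (tensorForm β)) E) : Prop where
  isHeisenbergRep : IsHeisenbergRep ψ π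
  implements : Implements Heisenberg.act π ω
  transvection_apply : ∀ {i j : Fin 2} (hij : i ≠ j) (c : F),
    ∀ v ∈ fixedSpace π (tensorVec U (Pi.single i 1)), resSL ω (transvection hij c) v = v

variable {π : Representation ℂ (Heisenberg (tensorForm β)) E}
  {ω : Representation ℂ (SpGroup (tensorForm β)) E}

lemma IsHeisenbergRep.exists_mem_fixedSpace_tensorVec [NeZero (2 : F)] [Finite F]
    [Module.Finite F U] (hπ : IsHeisenbergRep ψ π) (hψ : ψ ≠ 1) (hβ : β.IsSymm)
    (hnd : β.SeparatingRight) (i : Fin 2) :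
    ∃ v ∈ fixedSpace π (tensorVec U (Pi.single i 1)), v ≠ 0 := by
  have := hπ.nontrivial
  have : Finite (U ⊗[F] (Fin 2 → F)) := Module.finite_of_finite F
  exact exists_mem_fixedSpace_ne_zero hπ.hasCentralChar hψ (tensorForm_isAlt hβ)
    (tensorForm_separatingRight hnd) (isLagrangian_tensorVec hnd i)

/-- The transvections with a given axis are commutators of a similitude and a transvection with
the same axis. -/
lemma isNormalizedOscillator_of_similitude [NeZero (2 : F)] [Finite F] [Module.Finite F U]
    (hπ : IsHeisenbergRep ψ π) (hω : Implements Heisenberg.act π ω) (hψ : ψ ≠ 1)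
    (hβ : β.IsSymm) (hnd : β.SeparatingRight) {μ : F} (hμ : μ ≠ 0) (hμ₁ : μ ≠ 1)
    {A : U ≃ₗ[F] U} (hA : ∀ x y, β (A x) (A y) = μ * β x y) :
    IsNormalizedOscillator ψ π ω := by
  refine ⟨hπ, hω, fun {i j} hij c v hv => ?_⟩
  have : Finite (U ⊗[F] (Fin 2 → F)) := Module.finite_of_finite F
  obtain ⟨c', hc'⟩ := exists_similitude_mul_transvection (hμ := hμ) (hA := hA) hμ₁ hij c
  exact hω.apply_eq_self_of_mul_eq hπ hψ (tensorForm_isAlt hβ) (isLagrangian_tensorVec hnd i)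
    (tensorVec_le_map_similitude i)
    (fun w hw => ⟨w, hw, slToSp_transvection_apply hij c' hw⟩) hc' hv

lemma IsOscillatorRep.exists_implements (hω : IsOscillatorRep ψ ω) :
    ∃ π, IsHeisenbergRep ψ π ∧ Implements Heisenberg.act π ω := by
  obtain ⟨π, hπ, h, -⟩ := hω
  exact ⟨π, hπ, fun g k v => by simp [← h]⟩

end Normalized

section Line

variable {F : Type*} [Field F] {ψ : AddChar F ℂ} {a : F} {E : Type*} [AddCommGroup E] [Module ℂ E]

@[simp]
lemma lineForm_apply (a x y : F) : lineForm a x y = a * (x * y) := rfl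

lemma lineForm_isSymm (a : F) : (lineForm a).IsSymm :=
  ⟨fun x y => by simp [mul_comm x]⟩

lemma lineForm_separatingRight (ha : a ≠ 0) : (lineForm a).SeparatingRight := fun y hy => by
  simpa [ha] using hy 1

lemma IsOscillatorRep.exists_isNormalizedOscillator [Finite F] [NeZero (2 : F)] (hψ : ψ ≠ 1)
    (ha : a ≠ 0) {ω : Representation ℂ (SpGroup (tensorForm (lineForm a))) E}
    (hω : IsOscillatorRep ψ ω) : ∃ π, IsNormalizedOscillator ψ π ω := by
  by_cases h3 : Nat.card F = 3
  · obtain ⟨π, hπ, h, hcan⟩ := hω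
    refine ⟨π, hπ, fun g k v => by simp [← h], fun {i j} hij c v hv => ?_⟩
    have hw : (1 : F) ⊗ₜ[F] (Pi.single i 1 : Fin 2 → F) ∈ tensorVec F (Pi.single i 1) := ⟨1, rfl⟩
    refine hcan h3 (by simp) _ _ v (fun h0 => ?_) (slToSp_transvection_apply hij c hw) (hv _ hw)
    simpa using congrArg (TensorProduct.lid F (Fin 2 → F)) h0
  · obtain ⟨π, hπ, himp⟩ := hω.exists_implements
    obtain ⟨b, hb, hb₁⟩ := exists_sq_ne_one h3
    refine ⟨π, isNormalizedOscillator_of_similitude hπ himp hψ (lineForm_isSymm a)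
      (lineForm_separatingRight ha) (pow_ne_zero 2 hb) hb₁
      (A := .smulOfNeZero F F b hb) fun x y => ?_⟩
    simp only [LinearEquiv.smulOfNeZero_apply, lineForm_apply, smul_eq_mul]
    ring

end Line

section Plane

variable {F U : Type*} [Field F] [Finite F] [NeZero (2 : F)] [AddCommGroup U] [Module F U]
  {β : LinearMap.BilinForm F U} {a₁ a₂ : F} {e : U ≃ₗ[F] F × F}

/-- The multiplication by an element of norm `-1` in the quadratic algebra whose norm form is
`s² + (a₂ / a₁) t²`. -/
lemma IsOrthogonalSum.exists_similitude_neg_one (ha₁ : a₁ ≠ 0) (ha₂ : a₂ ≠ 0)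
    (he : IsOrthogonalSum e β (lineForm a₁) (lineForm a₂)) :
    ∃ A : U ≃ₗ[F] U, ∀ x y, β (A x) (A y) = -1 * β x y := by
  obtain ⟨s, t, hst⟩ := exists_mul_sq_add_mul_sq_eq one_ne_zero (div_ne_zero ha₂ ha₁) (-1)
  let f (s : F) : F × F →ₗ[F] F × F :=
    .prod (s • .fst F F F - (a₂ / a₁ * t) • .snd F F F) (t • .fst F F F + s • .snd F F F)
  have hf s p : f s p = (s * p.1 - a₂ / a₁ * t * p.2, t * p.1 + s * p.2) := rfl
  have hinv (r : F) (hr : r ^ 2 = s ^ 2) : f r ∘ₗ f (-r) = .id := by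
    refine LinearMap.ext fun p => Prod.ext ?_ ?_ <;>
      simp only [LinearMap.comp_apply, hf, LinearMap.id_apply]
    · linear_combination -p.1 * (hst + hr)
    · linear_combination -p.2 * (hst + hr)
  refine ⟨e ≪≫ₗ .ofLinearMap (f s) (f (-s)) (hinv s rfl)
    (by simpa using hinv (-s) (neg_sq s)) ≪≫ₗ e.symm, fun x y => ?_⟩
  simp only [he _ _, LinearEquiv.trans_apply, LinearEquiv.apply_symm_apply,
    LinearEquiv.coe_ofLinearMap, hf, lineForm_apply]
  have hcancel : a₁ * (a₂ / a₁) = a₂ := mul_div_cancel₀ a₂ ha₁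
  generalize a₂ / a₁ = d at *
  subst hcancel
  linear_combination
    (a₁ * ((e x).1 * (e y).1) + a₁ * d * ((e x).2 * (e y).2)) * hst

lemma IsOrthogonalSum.exists_isNormalizedOscillator (ha₁ : a₁ ≠ 0) (ha₂ : a₂ ≠ 0)
    (he : IsOrthogonalSum e β (lineForm a₁) (lineForm a₂)) {ψ : AddChar F ℂ} (hψ : ψ ≠ 1)
    {E : Type*} [AddCommGroup E] [Module ℂ E] {ω : Representation ℂ (SpGroup (tensorForm β)) E}
    (hω : IsOscillatorRep ψ ω) : ∃ π, IsNormalizedOscillator ψ π ω := by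
  obtain ⟨π, hπ, himp⟩ := hω.exists_implements
  obtain ⟨A, hA⟩ := he.exists_similitude_neg_one ha₁ ha₂
  have : Module.Finite F U := .equiv e.symm
  exact ⟨π, isNormalizedOscillator_of_similitude hπ himp hψ
    (he.isSymm (lineForm_isSymm a₁) (lineForm_isSymm a₂))
    (he.separatingRight (lineForm_separatingRight ha₁) (lineForm_separatingRight ha₂))
    (neg_ne_zero.2 one_ne_zero) (Ring.neg_one_ne_one_of_char_ne_two ringChar_ne_two) hA⟩

end Plane

section OscillatorTensor

lemma tmul_ne_zero {k M N : Type*} [Field k] [AddCommGroup M] [Module k M] [AddCommGroup N]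
    [Module k N] {x : M} {y : N} (hx : x ≠ 0) (hy : y ≠ 0) : x ⊗ₜ[k] y ≠ 0 := by
  have hx' := LinearIndependent.of_subsingleton (R := k) (v := fun _ : Unit => x) () hx
  have hy' := LinearIndependent.of_subsingleton (R := k) (v := fun _ : Unit => y) () hy
  exact (hx'.tmul_of_isDomain hy').ne_zero ((), ())

open Matrix.SpecialLinearGroup (transvection)

variable {F U U₁ U₂ : Type*} [Field F] [NeZero (2 : F)] [Finite F] [AddCommGroup U] [Module F U]
  [AddCommGroup U₁] [Module F U₁] [AddCommGroup U₂] [Module F U₂]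
  [Module.Finite F U₁] [Module.Finite F U₂] {β : LinearMap.BilinForm F U}
  {β₁ : LinearMap.BilinForm F U₁} {β₂ : LinearMap.BilinForm F U₂} {e : U ≃ₗ[F] U₁ × U₂}
  {ψ : AddChar F ℂ} {E E₁ E₂ : Type*} [AddCommGroup E] [Module ℂ E] [AddCommGroup E₁]
  [Module ℂ E₁] [AddCommGroup E₂] [Module ℂ E₂]

lemma IsNormalizedOscillator.nonempty_equiv_tprod
    (he : IsOrthogonalSum e β β₁ β₂) (hψ : ψ ≠ 1)
    (hβ₁ : β₁.IsSymm) (hnd₁ : β₁.SeparatingRight) (hβ₂ : β₂.IsSymm) (hnd₂ : β₂.SeparatingRight)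
    {π : Representation ℂ (Heisenberg (tensorForm β)) E}
    {ω : Representation ℂ (SpGroup (tensorForm β)) E} (hω : IsNormalizedOscillator ψ π ω)
    {π₁ : Representation ℂ (Heisenberg (tensorForm β₁)) E₁}
    {ω₁ : Representation ℂ (SpGroup (tensorForm β₁)) E₁} (hω₁ : IsNormalizedOscillator ψ π₁ ω₁)
    {π₂ : Representation ℂ (Heisenberg (tensorForm β₂)) E₂}
    {ω₂ : Representation ℂ (SpGroup (tensorForm β₂)) E₂} (hω₂ : IsNormalizedOscillator ψ π₂ ω₂) :
    Nonempty ((resSL ω).Equiv ((resSL ω₁).tprod (resSL ω₂))) := by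
  have : Module.Finite F U := .equiv e.symm
  have : Finite (U ⊗[F] (Fin 2 → F)) := Module.finite_of_finite F
  have hπ₁ := hω₁.isHeisenbergRep
  have hπ₂ := hω₂.isHeisenbergRep
  have heV := isOrthogonalSum_tensorProdEquiv he
  obtain ⟨T, χ, hχ⟩ := Implements.exists_equiv_tprod heV hω.isHeisenbergRep hπ₁ hπ₂ hψ
    (tensorForm_isAlt hβ₁) (tensorForm_separatingRight hnd₁) (tensorForm_isAlt hβ₂)
    (tensorForm_separatingRight hnd₂) (ρ := resSL ω) (ρ₁ := resSL ω₁) (ρ₂ := resSL ω₂)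
    (fun g => hω.implements (slToSp β g)) (fun g => hω₁.implements (slToSp β₁ g))
    (fun g => hω₂.implements (slToSp β₂ g)) (tensorProdEquiv_slToSp e)
  have hχ₁ : ∀ g, χ g = 1 := by
    refine Matrix.SL2.transvection_induction _ (fun i j hij c => ?_)
      (fun g h hg hh => by rw [map_mul, hg, hh, one_mul])
    obtain ⟨v₁, hv₁, hv₁'⟩ := hπ₁.exists_mem_fixedSpace_tensorVec hψ hβ₁ hnd₁ i
    obtain ⟨v₂, hv₂, hv₂'⟩ := hπ₂.exists_mem_fixedSpace_tensorVec hψ hβ₂ hnd₂ i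
    have hT : T (v₁ ⊗ₜ v₂) ≠ 0 := T.toLinearEquiv.map_ne_zero_iff.2 (tmul_ne_zero hv₁' hv₂')
    have hfix : T (v₁ ⊗ₜ v₂) ∈ fixedSpace π (tensorVec U (Pi.single i 1)) :=
      fixedSpace_le_comap T (tmul_mem_fixedSpace_heisenbergTensor heV _ _
        (fun w => tensorProdEquiv_mem_tensorVec e) hv₁ hv₂)
    have h := hχ (transvection hij c) (v₁ ⊗ₜ v₂)
    rw [hω.transvection_apply hij c _ hfix, Representation.tprod_apply, TensorProduct.map_tmul,
      hω₁.transvection_apply hij c _ hv₁, hω₂.transvection_apply hij c _ hv₂] at h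
    exact smul_left_injective ℂ hT (by simpa using h.symm)
  exact ⟨(Representation.Equiv.mk T.toLinearEquiv fun g => LinearMap.ext fun x =>
    (hχ g x).trans (by rw [hχ₁, one_smul]; rfl)).symm⟩

end OscillatorTensor

section DiagonalPlane

variable {F U : Type*} [Field F] [AddCommGroup U] [Module F U]
  {β : LinearMap.BilinForm F U} {a c : F}

lemma planeForm_apply (c : F) (x y : Fin 2 → F) :
    planeForm c x y = x 0 * y 0 - c * (x 1 * y 1) := by
  simp only [planeForm, Matrix.toBilin'_apply, Fin.sum_univ_two, Matrix.of_apply,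
    Matrix.cons_val', Matrix.cons_val_zero, Matrix.cons_val_one, Matrix.cons_val_fin_one]
  ring

lemma exists_isOrthogonalSum_lineForm (e : β.IsometryEquiv (planeForm c)) (hc : c ≠ 0)
    (ha : a ≠ 0) (h : IsSquare (-c * a)) :
    ∃ f : U ≃ₗ[F] F × F, IsOrthogonalSum f β (lineForm 1) (lineForm a) := by
  obtain ⟨s, hs⟩ := h
  have hs₀ : s ≠ 0 := by rintro rfl; simp [hc, ha] at hs
  refine ⟨e.toLinearEquiv ≪≫ₗ .finTwoArrow F F ≪≫ₗ
    .prodCongr (.refl F F) (.smulOfNeZero F F (s / a) (div_ne_zero hs₀ ha)), fun x y => ?_⟩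
  have hsa : a * (s / a) ^ 2 = -c := by
    field_simp
    linear_combination -hs
  rw [← e.map_app' x y]
  change planeForm c (e.toLinearEquiv x) (e.toLinearEquiv y) = _
  simp only [planeForm_apply, lineForm_apply, LinearEquiv.trans_apply,
    LinearEquiv.prodCongr_apply, LinearEquiv.finTwoArrow_apply, LinearEquiv.refl_apply,
    LinearEquiv.smulOfNeZero_apply, smul_eq_mul]
  linear_combination -(e.toLinearEquiv x 1 * e.toLinearEquiv y 1) * hsa

theorem IsOscillatorRep.nonempty_equiv_tprod [Finite F] [NeZero (2 : F)] {ψ : AddChar F ℂ}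
    (hψ : ψ ≠ 1) {E E₁ E₂ : Type*} [AddCommGroup E] [Module ℂ E] [AddCommGroup E₁] [Module ℂ E₁]
    [AddCommGroup E₂] [Module ℂ E₂]
    (e : β.IsometryEquiv (planeForm c)) (hc : c ≠ 0) (ha : a ≠ 0) (h : IsSquare (-c * a))
    {ω : Representation ℂ (SpGroup (tensorForm β)) E} (hω : IsOscillatorRep ψ ω)
    {ω₁ : Representation ℂ (SpGroup (tensorForm (lineForm (1 : F)))) E₁}
    (hω₁ : IsOscillatorRep ψ ω₁)
    {ω₂ : Representation ℂ (SpGroup (tensorForm (lineForm a))) E₂} (hω₂ : IsOscillatorRep ψ ω₂) :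
    Nonempty ((resSL ω).Equiv ((resSL ω₁).tprod (resSL ω₂))) := by
  obtain ⟨f, hf⟩ := exists_isOrthogonalSum_lineForm e hc ha h
  obtain ⟨π, hω⟩ := hf.exists_isNormalizedOscillator one_ne_zero ha hψ hω
  obtain ⟨π₁, hω₁⟩ := hω₁.exists_isNormalizedOscillator hψ one_ne_zero
  obtain ⟨π₂, hω₂⟩ := hω₂.exists_isNormalizedOscillator hψ ha
  exact hω.nonempty_equiv_tprod hf hψ (lineForm_isSymm 1) (lineForm_separatingRight one_ne_zero)
    (lineForm_isSymm a) (lineForm_separatingRight ha) hω₁ hω₂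

end DiagonalPlane

end

theorem proposition4
    {F : Type*} [Field F] [Finite F] (hF : Odd (Nat.card F))
    (ψ : AddChar F ℂ) (hψ : ψ ≠ 1)
    (ε : F) (hε : ¬ IsSquare ε)
    {U : Type*} [AddCommGroup U] [Module F U] (β : LinearMap.BilinForm F U)
    {E Ep Em : Type*} [AddCommGroup E] [Module ℂ E] [AddCommGroup Ep] [Module ℂ Ep]
    [AddCommGroup Em] [Module ℂ Em]
    (ω : Representation ℂ (SpGroup (tensorForm β)) E) (hω : IsOscillatorRep ψ ω)
    (ωp : Representation ℂ (SpGroup (tensorForm (lineForm (1 : F)))) Ep)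
    (hωp : IsOscillatorRep ψ ωp)
    (ωm : Representation ℂ (SpGroup (tensorForm (lineForm ε))) Em)
    (hωm : IsOscillatorRep ψ ωm) :
    (Nonempty (β.IsometryEquiv (planeForm 1)) →
      (Nat.card F % 4 = 1 →
        Nonempty ((resSL ω).Equiv ((resSL ωp).tprod (resSL ωp)))) ∧
      (Nat.card F % 4 = 3 →
        Nonempty ((resSL ω).Equiv ((resSL ωp).tprod (resSL ωm))))) ∧
    (Nonempty (β.IsometryEquiv (planeForm ε)) →
      (Nat.card F % 4 = 1 →
        Nonempty ((resSL ω).Equiv ((resSL ωp).tprod (resSL ωm)))) ∧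
      (Nat.card F % 4 = 3 →
        Nonempty ((resSL ω).Equiv ((resSL ωp).tprod (resSL ωp))))) := by
  have : NeZero (2 : F) := ⟨two_ne_zero_of_odd_card hF⟩
  have hε₀ : ε ≠ 0 := by rintro rfl; exact hε .zero
  have hsq (h : Nat.card F % 4 = 1) : IsSquare (-1 : F) := isSquare_neg_one_iff_card.2 (by omega)
  have hns (h : Nat.card F % 4 = 3) : IsSquare (-1 * ε) :=
    isSquare_mul_of_not_isSquare (fun h' => isSquare_neg_one_iff_card.1 h' h) hε
  refine ⟨fun ⟨e⟩ => ⟨fun h => ?_, fun h => ?_⟩, fun ⟨e⟩ => ⟨fun h => ?_, fun h => ?_⟩⟩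
  · exact hω.nonempty_equiv_tprod hψ e one_ne_zero one_ne_zero (by simpa using hsq h) hωp hωp
  · exact hω.nonempty_equiv_tprod hψ e one_ne_zero hε₀ (hns h) hωp hωm
  · have hεε : IsSquare (-ε * ε) := by simpa using (hsq h).mul (IsSquare.mul_self ε)
    exact hω.nonempty_equiv_tprod hψ e hε₀ hε₀ hεε hωp hωm
  · exact hω.nonempty_equiv_tprod hψ e hε₀ one_ne_zero (by simpa using hns h) hωp hωp
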